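/- Let $n\ge 0$, $T>0$, and let $v=(v_1,\dots,v_n):\mathbb R\times\mathbb R^n\times\mathbb R^n\to\mathbb R^n$, $(t,x,y)\mapsto v(t,x,y)$, be infinitely smooth and $T$-periodic in $t$. Consider the system $$\ddot x_j = v_j(t,x,\dot x),\qquad j=1,\dots,n. \tag{1}$$ Suppose there are infinitely smooth $T$-periodic functions $x_1^j,x_2^j:\mathbb R\to\mathbb R$ $(1\le j\le n)$ such that for all $t\in\mathbb R$ and all $j$: 1. $x_1^j(t)<x_2^j(t)$; 2. $\ddot x_1^j(t)>v_j(t,x,y)$ for all $x,y\in\mathbb R^n$ with $x_i\in[x_1^i(t),x_2^i(t)]$ for every $i$, $x_j=x_1^j(t)$ and $y_j=\dot x_1^j(t)$ (the velocities $y_i$, $i\ne j$, being arbitrary); 3. $\ddot x_2^j(t)<v_j(t,x,y)$ for all $x,y\in\mathbb R^n$ with $x_i\in[x_1^i(t),x_2^i(t)]$ for every $i$, $x_j=x_2^j(t)$ and $y_j=\dot x_2^j(t)$ (the velocities $y_i$, $i\ne j$, being arbitrary). Suppose also that there are real constants $a,b$ and $\delta>0$ such that, with the Euclidean norm, $\|v(t,x,y)\|\le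 a+b\|y\|^{2-\delta}$ for all $t\in\mathbb R$ and $x,y\in\mathbb R^n$ with $y\neq 0$. Then the system (1) has a $T$-periodic solution $x=(x_1,\dots,x_n):\mathbb R\to\mathbb R^n$ such that $x_1^j(t)<x_j(t)<x_2^j(t)$ for every $j$ and all $t\in\mathbb R$. -/

import Mathlib

open scoped ContDiff

/-- `x` is a (twice differentiable, everywhere defined) solution of the second order system
`x'' = v (t, x, x')` in `ℝⁿ`. -/
def IsSecondOrderSolution {n : ℕ}
    (v : ℝ → EuclideanSpace ℝ (Fin n) → EuclideanSpace ℝ (Fin n) → EuclideanSpace ℝ (Fin n))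
    (x : ℝ → EuclideanSpace ℝ (Fin n)) : Prop :=
  ∀ t : ℝ, DifferentiableAt ℝ x t ∧ HasDerivAt (deriv x) (v t (x t) (deriv x t)) t

/-!
Clamping the position to the box between the barriers and the velocity components to `[-R, R]`
turns the system into `x'' = x + g (t, x, x')` with `g` bounded. The operator `x'' - x` is
invertible on `T`-periodic functions, so the `T`-periodic solutions of the truncated system are the
fixed points of a compact integral operator, and Schauder's theorem provides one. Wherever such a
solution touches or crosses a barrier with the slope of the barrier, the strict inequalities
contradict the second derivative test at the minimum of the distance to the barrier; hence the
solution stays strictly between the barriers and the position was never truncated. Finally, if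
`‖x‖ ≤ B` and `‖x''‖ ≤ Q` then `‖x'‖² ≤ 8 B Q`, and subquadratic growth of `v` makes `Q = o(R²)`, so
for large `R` the velocity was not truncated either.

Schauder's theorem follows from Brouwer's by projecting onto finite nets. For Brouwer's theorem,
let `g` be of class `C¹` with support in a compact set `K`. For a polynomial `φ` the integral of
`φ(‖x + t g(x)‖²) det(1 + t Dg(x))` over `K` is a polynomial in `t`, and by change of variables it
is constant for small `t`, where `id + t g` is a diffeomorphism; hence it is constant up to
`t = 1`. By approximation this extends to continuous `φ`, and if `id + g` had no zero, it would fail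
for a `φ ≥ 0` which vanishes at all values of `‖x + g(x)‖²` on `K` but not at `0`.
-/

open Filter MeasureTheory Metric Set
open scoped Polynomial Topology

section EuclideanSpace

variable {ι : Type*} [Fintype ι] {x : EuclideanSpace ℝ ι} {M : ℝ}

lemma norm_le_sqrt_card_mul (hM : 0 ≤ M) (hx : ∀ i, |x i| ≤ M) :
    ‖x‖ ≤ √(Fintype.card ι) * M := by
  calc ‖x‖ = √(∑ i, |x i| ^ 2) := EuclideanSpace.norm_eq x
    _ ≤ √(∑ _i : ι, M ^ 2) := by gcongr with i; exact hx i
    _ = √(Fintype.card ι) * M := by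
      rw [Finset.sum_const, nsmul_eq_mul, Real.sqrt_mul (by positivity), Real.sqrt_sq hM,
        Finset.card_univ]

end EuclideanSpace

lemma exists_polynomial_eval_eq_integral {X : Type*} [MeasurableSpace X] {μ : Measure X}
    (p : X → ℝ[X]) (n : ℕ) (hn : ∀ x, (p x).degree < n)
    (hint : ∀ t : ℝ, Integrable (fun x => (p x).eval t) μ) :
    ∃ P : ℝ[X], ∀ t, P.eval t = ∫ x, (p x).eval t ∂μ := by
  have hinj : InjOn (Nat.cast : ℕ → ℝ) (Finset.range n) := Nat.cast_injective.injOn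
  have hp : ∀ x t, (p x).eval t = ∑ i ∈ Finset.range n,
      (p x).eval (i : ℝ) * (Lagrange.basis (Finset.range n) (Nat.cast : ℕ → ℝ) i).eval t := by
    intro x t
    conv_lhs => rw [Lagrange.eq_interpolate (f := p x) hinj (by simpa using hn x)]
    simp only [Lagrange.interpolate_apply, Polynomial.eval_finsetSum, Polynomial.eval_mul,
      Polynomial.eval_C]
  refine ⟨Lagrange.interpolate (Finset.range n) Nat.cast
    fun i => ∫ x, (p x).eval (i : ℝ) ∂μ, fun t => ?_⟩
  simp_rw [hp _ t, Lagrange.interpolate_apply, Polynomial.eval_finsetSum, Polynomial.eval_mul,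
    Polynomial.eval_C]
  rw [integral_finsetSum (Finset.range n) fun i _ => (hint i).mul_const _]
  simp_rw [integral_mul_const]

lemma image_eq_of_forall_notMem {α : Type*} {f : α → α} (hf : f.Bijective) {s : Set α}
    (h : ∀ x ∉ s, f x = x) : f '' s = s := by
  rw [← compl_inj_iff, ← image_compl_eq hf]
  exact (image_congr h).trans (image_id' _)

section NormedSpace

variable {E : Type*} [NormedAddCommGroup E] [NormedSpace ℝ E]

lemma eventually_bijective_id_add_smul [CompleteSpace E] {g : E → E} {L : NNReal}
    (hg : LipschitzWith L g) : ∀ᶠ t : ℝ in 𝓝 0, (fun x => x + t • g x).Bijective := by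
  have hsmall : ∀ᶠ t : ℝ in 𝓝 0, ‖t‖₊ * L < 1 :=
    (show Continuous fun t : ℝ => ‖t‖₊ * L by fun_prop).continuousAt.eventually_lt_const (by simp)
  filter_upwards [hsmall] with t ht
  have happrox : ApproximatesLinearOn (fun x => x + t • g x)
      (ContinuousLinearEquiv.refl ℝ E : E →L[ℝ] E) univ (‖t‖₊ * L) := by
    rw [ApproximatesLinearOn.approximatesLinearOn_iff_lipschitzOnWith, lipschitzOnWith_univ,
      show (fun x => x + t • g x) - ⇑(ContinuousLinearEquiv.refl ℝ E : E →L[ℝ] E) =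
        (t • ·) ∘ g from funext fun x => add_sub_cancel_left x (t • g x)]
    exact (lipschitzWith_smul t).comp hg
  have hc : Subsingleton E ∨
      ‖t‖₊ * L < ‖((ContinuousLinearEquiv.refl ℝ E).symm : E →L[ℝ] E)‖₊⁻¹ := by
    rcases subsingleton_or_nontrivial E with h | h
    · exact .inl h
    · exact .inr (by simpa using ht)
  exact ⟨injOn_univ.1 (injOn_iff_injective.2 (happrox.injective hc)), happrox.surjective hc⟩

variable [FiniteDimensional ℝ E]

lemma exists_polynomial_eval_eq_det (A : E →L[ℝ] E) :
    ∃ p : ℝ[X], p.natDegree ≤ Module.finrank ℝ E ∧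
      ∀ t : ℝ, p.eval t = (ContinuousLinearMap.id ℝ E + t • A).det := by
  classical
  let b := Module.finBasis ℝ E
  let M := LinearMap.toMatrix b b A.toLinearMap
  refine ⟨((.X : ℝ[X]) • M.map Polynomial.C + (1 : Matrix _ _ ℝ).map Polynomial.C).det,
    by simpa using Polynomial.natDegree_det_X_add_C_le M 1, fun t => ?_⟩
  have hdet : (ContinuousLinearMap.id ℝ E + t • A).det = (t • M + 1).det := by
    rw [ContinuousLinearMap.det, ← LinearMap.det_toMatrix b, add_comm]
    simp [M, map_add, map_smul]
  rw [hdet, ← Polynomial.coe_evalRingHom, RingHom.map_det]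
  congr 1
  ext i j
  simp [Matrix.one_apply, apply_ite (Polynomial.eval t)]
  ring

lemma eventually_setIntegral_comp_mul_det_eq [MeasurableSpace E] [BorelSpace E] (μ : Measure E)
    [μ.IsAddHaarMeasure] {g : E → E} {L : NNReal} (hg : Differentiable ℝ g)
    (hL : LipschitzWith L g) {s : Set E} (hs : MeasurableSet s) (hgs : ∀ x ∉ s, g x = 0) :
    ∀ᶠ t : ℝ in 𝓝 0, ∀ φ : E → ℝ,
      ∫ x in s, φ (x + t • g x) * (ContinuousLinearMap.id ℝ E + t • fderiv ℝ g x).det ∂μ =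
        ∫ x in s, φ x ∂μ := by
  have hdet : ∀ᶠ B : E →L[ℝ] E in 𝓝 0, 0 < (ContinuousLinearMap.id ℝ E + B).det :=
    (ContinuousLinearMap.continuous_det.comp
      (continuous_const.add continuous_id)).continuousAt.eventually_const_lt
      (by simp [ContinuousLinearMap.det])
  obtain ⟨η, hη, hdet⟩ := Metric.eventually_nhds_iff.1 hdet
  have hsmall : ∀ᶠ t : ℝ in 𝓝 0, ‖t‖ * L < η :=
    (show Continuous fun t : ℝ => ‖t‖ * L by fun_prop).continuousAt.eventually_lt_const (by simpa)
  filter_upwards [hsmall, eventually_bijective_id_add_smul hL] with t ht hbij φ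
  have hpos : ∀ x, 0 < (ContinuousLinearMap.id ℝ E + t • fderiv ℝ g x).det := by
    refine fun x => hdet ?_
    rw [dist_zero_right, norm_smul]
    exact (mul_le_mul_of_nonneg_left (norm_fderiv_le_of_lipschitz ℝ hL) (norm_nonneg t)).trans_lt ht
  have himage : (fun x => x + t • g x) '' s = s :=
    image_eq_of_forall_notMem hbij fun x hx => by rw [hgs x hx, smul_zero, add_zero]
  have hderiv : ∀ x, HasFDerivAt (fun x => x + t • g x)
      (ContinuousLinearMap.id ℝ E + t • fderiv ℝ g x) x := fun x =>
    (hasFDerivAt_id x).add ((hg x).hasFDerivAt.const_smul t)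
  have hchange := integral_image_eq_integral_abs_det_fderiv_smul μ hs
    (fun x _ => (hderiv x).hasFDerivWithinAt) hbij.injective.injOn φ
  simp_rw [himage, abs_of_pos (hpos _), smul_eq_mul] at hchange
  simp_rw [hchange, mul_comm]

end NormedSpace

lemma tendsto_setIntegral_comp_mul {X : Type*} [TopologicalSpace X] [T2Space X]
    [MeasurableSpace X] [BorelSpace X] {μ : Measure X} [IsFiniteMeasureOnCompacts μ] {K : Set X}
    (hK : IsCompact K) {u w : X → ℝ} (hu : Continuous u) (hw : Continuous w) {p : ℕ → ℝ → ℝ}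
    {φ : ℝ → ℝ} (hp : ∀ n, Continuous (p n)) (hlim : TendstoUniformlyOn p φ atTop (u '' K)) :
    Tendsto (fun n => ∫ x in K, p n (u x) * w x ∂μ) atTop (𝓝 (∫ x in K, φ (u x) * w x ∂μ)) := by
  have hφ : ContinuousOn φ (u '' K) :=
    hlim.continuousOn (Frequently.of_forall fun n => (hp n).continuousOn)
  obtain ⟨C, hC⟩ := (hK.image hu).exists_bound_of_continuousOn hφ
  have hev : ∀ᶠ n in atTop, ∀ x ∈ K, |p n (u x)| ≤ C + 1 := by
    filter_upwards [Metric.tendstoUniformlyOn_iff.1 hlim 1 one_pos] with n hn x hx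
    have h := abs_sub_lt_iff.1 (hn _ (mem_image_of_mem u hx))
    have h' := abs_le.1 (hC _ (mem_image_of_mem u hx))
    exact abs_le.2 ⟨by linarith, by linarith⟩
  refine tendsto_integral_filter_of_dominated_convergence (fun x => (C + 1) * |w x|)
    (.of_forall fun n => (((hp n).comp hu).mul hw).aestronglyMeasurable) ?_
    (ContinuousOn.integrableOn_compact hK (by fun_prop)) ?_
  · filter_upwards [hev] with n hn
    refine (ae_restrict_iff' hK.measurableSet).2 (.of_forall fun x hx => ?_)
    rw [norm_mul, Real.norm_eq_abs, Real.norm_eq_abs]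
    exact mul_le_mul_of_nonneg_right (hn x hx) (abs_nonneg _)
  · refine (ae_restrict_iff' hK.measurableSet).2 (.of_forall fun x hx => ?_)
    exact (hlim.tendsto_at (mem_image_of_mem u hx)).mul_const _

section InnerProductSpace

variable {E : Type*} [NormedAddCommGroup E] [InnerProductSpace ℝ E]

lemma exists_polynomial_eval_eq_norm_sq (x y : E) :
    ∃ p : ℝ[X], p.natDegree ≤ 2 ∧ ∀ t : ℝ, p.eval t = ‖x + t • y‖ ^ 2 := by
  refine ⟨.C (‖y‖ ^ 2) * .X ^ 2 + .C (2 * inner ℝ x y) * .X + .C (‖x‖ ^ 2), by compute_degree,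
    fun t => ?_⟩
  rw [norm_add_sq_real, norm_smul, inner_smul_right, mul_pow, Real.norm_eq_abs, sq_abs]
  simp only [Polynomial.eval_add, Polynomial.eval_mul, Polynomial.eval_C, Polynomial.eval_X,
    Polynomial.eval_pow]
  ring

variable [FiniteDimensional ℝ E]

lemma exists_polynomial_eval_eq_comp_norm_sq_mul_det (q : ℝ[X]) (x y : E) (A : E →L[ℝ] E) :
    ∃ p : ℝ[X], p.natDegree ≤ q.natDegree * 2 + Module.finrank ℝ E ∧ ∀ t : ℝ,
      p.eval t = q.eval (‖x + t • y‖ ^ 2) * (ContinuousLinearMap.id ℝ E + t • A).det := by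
  obtain ⟨r, hr, hr'⟩ := exists_polynomial_eval_eq_norm_sq x y
  obtain ⟨d, hd, hd'⟩ := exists_polynomial_eval_eq_det A
  refine ⟨q.comp r * d, Polynomial.natDegree_mul_le.trans ?_, fun t => by
    rw [Polynomial.eval_mul, Polynomial.eval_comp, hr', hd']⟩
  gcongr
  exact Polynomial.natDegree_comp_le.trans (by gcongr)

variable {g : E → E} {K : Set E}

section Measure

variable [MeasurableSpace E] [BorelSpace E] (μ : Measure E) [μ.IsAddHaarMeasure]

lemma setIntegral_eval_norm_sq_mul_det_eq (hg : ContDiff ℝ 1 g) (hK : IsCompact K)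
    (hgK : ∀ x ∉ K, g x = 0) (q : ℝ[X]) :
    ∫ x in K, q.eval (‖x + g x‖ ^ 2) * (ContinuousLinearMap.id ℝ E + fderiv ℝ g x).det ∂μ =
      ∫ x in K, q.eval (‖x‖ ^ 2) ∂μ := by
  obtain ⟨L, hL⟩ := hg.lipschitzWith_of_hasCompactSupport (.intro hK hgK) one_ne_zero
  have hg' : Continuous (fderiv ℝ g) := hg.continuous_fderiv one_ne_zero
  have hgc := hg.continuous
  choose p hpd hp using fun x =>
    exists_polynomial_eval_eq_comp_norm_sq_mul_det q x (g x) (fderiv ℝ g x)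
  have hint : ∀ t : ℝ, IntegrableOn (fun x => (p x).eval t) K μ := fun t => by
    simp_rw [hp]
    refine ContinuousOn.integrableOn_compact hK (Continuous.continuousOn ?_)
    exact (q.continuous.comp (by fun_prop)).mul
      (ContinuousLinearMap.continuous_det.comp (continuous_const.add (hg'.const_smul t)))
  obtain ⟨P, hP⟩ := exists_polynomial_eval_eq_integral p _ (fun x =>
    Polynomial.degree_le_natDegree.trans_lt (Nat.cast_lt.2 (Nat.lt_succ_of_le (hpd x)))) hint
  have hsmall : ∀ᶠ t : ℝ in 𝓝 0,
      P.eval t = (Polynomial.C (∫ x in K, q.eval (‖x‖ ^ 2) ∂μ)).eval t := by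
    filter_upwards [eventually_setIntegral_comp_mul_det_eq μ (hg.differentiable one_ne_zero) hL
      hK.measurableSet hgK] with t ht
    rw [hP, Polynomial.eval_C, ← ht fun y => q.eval (‖y‖ ^ 2)]
    simp_rw [hp]
  have hone := congr_arg (Polynomial.eval 1)
    (Polynomial.eq_of_infinite_eval_eq _ _ (infinite_of_mem_nhds 0 hsmall))
  rw [hP, Polynomial.eval_C] at hone
  simpa only [hp, one_smul] using hone

lemma setIntegral_comp_norm_sq_mul_det_eq (hg : ContDiff ℝ 1 g) (hK : IsCompact K)
    (hgK : ∀ x ∉ K, g x = 0) {φ : ℝ → ℝ} (hφ : Continuous φ) :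
    ∫ x in K, φ (‖x + g x‖ ^ 2) * (ContinuousLinearMap.id ℝ E + fderiv ℝ g x).det ∂μ =
      ∫ x in K, φ (‖x‖ ^ 2) ∂μ := by
  have hgc := hg.continuous
  have hdet : Continuous fun x => (ContinuousLinearMap.id ℝ E + fderiv ℝ g x).det :=
    ContinuousLinearMap.continuous_det.comp
      (continuous_const.add (hg.continuous_fderiv one_ne_zero))
  obtain ⟨b₁, hb₁⟩ := hK.exists_bound_of_continuousOn
    (show Continuous fun x => ‖x + g x‖ ^ 2 by fun_prop).continuousOn
  obtain ⟨b₂, hb₂⟩ := hK.exists_bound_of_continuousOn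
    (show Continuous fun x : E => ‖x‖ ^ 2 by fun_prop).continuousOn
  choose q hq using fun n : ℕ => exists_polynomial_near_of_continuousOn 0 (max b₁ b₂) φ
    hφ.continuousOn (1 / (n + 1)) (by positivity)
  have hlim : TendstoUniformlyOn (fun n s => (q n).eval s) φ atTop (Icc 0 (max b₁ b₂)) := by
    refine Metric.tendstoUniformlyOn_iff.2 fun ε hε => ?_
    filter_upwards [tendsto_one_div_add_atTop_nhds_zero_nat.eventually_lt_const hε] with n hn s hs
    rw [dist_comm]
    exact (hq n s hs).trans hn
  have hrange₁ : (fun x => ‖x + g x‖ ^ 2) '' K ⊆ Icc 0 (max b₁ b₂) := by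
    rintro _ ⟨x, hx, rfl⟩
    exact ⟨sq_nonneg _, (Real.le_norm_self _).trans ((hb₁ x hx).trans (le_max_left _ _))⟩
  have hrange₂ : (fun x : E => ‖x‖ ^ 2) '' K ⊆ Icc 0 (max b₁ b₂) := by
    rintro _ ⟨x, hx, rfl⟩
    exact ⟨sq_nonneg _, (Real.le_norm_self _).trans ((hb₂ x hx).trans (le_max_right _ _))⟩
  have hlim₁ := tendsto_setIntegral_comp_mul (μ := μ) hK (by fun_prop) hdet
    (fun n => (q n).continuous) (hlim.mono hrange₁)
  have hlim₂ := tendsto_setIntegral_comp_mul (μ := μ) hK (by fun_prop)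
    (continuous_const (y := 1)) (fun n => (q n).continuous) (hlim.mono hrange₂)
  simp_rw [setIntegral_eval_norm_sq_mul_det_eq μ hg hK hgK] at hlim₁
  simp_rw [mul_one] at hlim₂
  exact tendsto_nhds_unique hlim₁ hlim₂

end Measure

lemma exists_add_eq_zero_of_contDiff (hg : ContDiff ℝ 1 g) (hK : IsCompact K)
    (hgK : ∀ x ∉ K, g x = 0) : ∃ x, x + g x = 0 := by
  by_contra! hne
  borelize E
  have hgc := hg.continuous
  have h0 : (0 : E) ∈ Function.support g := by simpa using hne 0
  have hsub : Function.support g ⊆ K := fun x hx => by_contra fun hxK => hx (hgK x hxK)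
  obtain ⟨x₀, -, hmin⟩ := hK.exists_isMinOn ⟨0, hsub h0⟩
    (show Continuous fun x => ‖x + g x‖ ^ 2 by fun_prop).continuousOn
  -- A cutoff which vanishes at all values of `‖x + g x‖ ^ 2` on `K`, but not at `‖0‖ ^ 2`.
  let φ : ℝ → ℝ := fun s => max 0 (‖x₀ + g x₀‖ ^ 2 - s)
  have hφ : Continuous φ := by fun_prop
  have hφ0 : 0 < φ (‖(0 : E)‖ ^ 2) := by
    have := norm_pos_iff.2 (hne x₀)
    simp only [φ, norm_zero, lt_max_iff]
    right
    nlinarith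
  have hzero : ∫ x in K, φ (‖x + g x‖ ^ 2) *
      (ContinuousLinearMap.id ℝ E + fderiv ℝ g x).det = 0 := by
    refine setIntegral_eq_zero_of_forall_eq_zero fun x hx => ?_
    have hle : ‖x₀ + g x₀‖ ^ 2 ≤ ‖x + g x‖ ^ 2 := hmin hx
    rw [show φ (‖x + g x‖ ^ 2) = 0 from max_eq_left (sub_nonpos.2 hle), zero_mul]
  have hpos : 0 < ∫ x in K, φ (‖x‖ ^ 2) := by
    have hU : IsOpen (Function.support g ∩ {x | 0 < φ (‖x‖ ^ 2)}) :=
      hgc.isOpen_support.inter (isOpen_lt continuous_const (by fun_prop))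
    refine (setIntegral_pos_iff_support_of_nonneg_ae (.of_forall fun x => le_max_left _ _)
      (ContinuousOn.integrableOn_compact hK (by fun_prop))).2 ?_
    exact (hU.measure_pos volume ⟨0, h0, hφ0⟩).trans_le (measure_mono fun x hx =>
      ⟨hx.2.ne', hsub hx.1⟩)
  rw [← setIntegral_comp_norm_sq_mul_det_eq volume hg hK hgK hφ, hzero] at hpos
  exact hpos.false

lemma exists_fixedPoint_of_continuous_of_bounded {f : E → E} (hf : Continuous f) {C : ℝ}
    (hC : ∀ x, ‖f x‖ ≤ C) : ∃ x, f x = x := by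
  by_contra! hne
  have hC0 : 0 ≤ C := (norm_nonneg _).trans (hC 0)
  let χ : ContDiffBump (0 : E) := ⟨C + 1, C + 2, by positivity, by linarith⟩
  have hχ : ∀ x, χ x • f x ≠ x := by
    intro x hx
    have hxC : ‖x‖ ≤ C := by
      rw [← hx, norm_smul, Real.norm_of_nonneg χ.nonneg]
      exact (mul_le_of_le_one_left (norm_nonneg _) χ.le_one).trans (hC x)
    refine hne x ?_
    rwa [χ.one_of_mem_closedBall (mem_closedBall_zero_iff.2 (hxC.trans (le_add_of_nonneg_right
      zero_le_one))), one_smul] at hx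
  obtain ⟨g, hg, hgf, hgs⟩ := (show Continuous fun x => χ x • f x from
    χ.continuous.smul hf).exists_contDiff_approx 1 (ε := fun x => dist (χ x • f x) x)
    ((χ.continuous.smul hf).dist continuous_id) fun x => dist_pos.2 (hχ x)
  obtain ⟨x, hx⟩ := exists_add_eq_zero_of_contDiff hg.neg χ.hasCompactSupport.isCompact
    fun x hx => by
      have hχx : χ x = 0 := image_eq_zero_of_notMem_tsupport hx
      have hgx : g x = 0 := Function.notMem_support.1 fun h => hgs h (by simp only [hχx, zero_smul])
      exact neg_eq_zero.2 hgx
  refine (hgf x).ne ?_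
  rw [show g x = x by simpa [sub_eq_zero, eq_comm, ← sub_eq_add_neg] using hx, dist_comm]

end InnerProductSpace

section Schauder

variable {E : Type*} [NormedAddCommGroup E] [NormedSpace ℝ E]

lemma exists_partition_dist_le {ι : Type*} [Fintype ι] {K : Set E} (c : ι → E) {ε : ℝ}
    (hc : K ⊆ ⋃ i, ball (c i) ε) :
    ∃ w : ι → E → ℝ, (∀ i, ContinuousOn (w i) K) ∧ (∀ y ∈ K, ∀ i, w i y ∈ Icc 0 1) ∧
      ∀ y ∈ K, dist (∑ i, w i y • c i) y ≤ ε := by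
  let d : ι → E → ℝ := fun i y => max 0 (ε - dist y (c i))
  have hd0 : ∀ i y, 0 ≤ d i y := fun i y => le_max_left _ _
  have hd : ∀ i, Continuous (d i) := fun i => by fun_prop
  have hsum : ∀ y ∈ K, 0 < ∑ i, d i y := by
    intro y hy
    obtain ⟨i, hi⟩ := mem_iUnion.1 (hc hy)
    exact Finset.sum_pos' (fun i _ => hd0 i y)
      ⟨i, Finset.mem_univ i, lt_max_of_lt_right (sub_pos.2 (mem_ball.1 hi))⟩
  refine ⟨fun i y => d i y / ∑ j, d j y, fun i => ?_, fun y hy i => ⟨?_, ?_⟩, fun y hy => ?_⟩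
  · exact (hd i).continuousOn.div (by fun_prop) fun y hy => (hsum y hy).ne'
  · exact div_nonneg (hd0 i y) (hsum y hy).le
  · exact div_le_one_of_le₀ (Finset.single_le_sum (fun j _ => hd0 j y) (Finset.mem_univ i))
      (hsum y hy).le
  · have hone : ∑ i, d i y / ∑ j, d j y = 1 := by
      rw [← Finset.sum_div, div_self (hsum y hy).ne']
    calc dist (∑ i, (d i y / ∑ j, d j y) • c i) y
        = ‖∑ i, (d i y / ∑ j, d j y) • (c i - y)‖ := by
          rw [dist_eq_norm]
          simp_rw [smul_sub, Finset.sum_sub_distrib, ← Finset.sum_smul, hone, one_smul]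
      _ ≤ ∑ i, d i y / (∑ j, d j y) * ε := by
          refine norm_sum_le_of_le _ fun i _ => ?_
          have hw := div_nonneg (hd0 i y) (hsum y hy).le
          rw [norm_smul, Real.norm_of_nonneg hw]
          rcases le_or_gt ‖c i - y‖ ε with h | h
          · gcongr
          · rw [show d i y = 0 from max_eq_left (by rw [dist_comm, dist_eq_norm]; linarith)]
            simp
      _ = ε := by rw [← Finset.sum_mul, hone, one_mul]

lemma exists_dist_le_of_mapsTo_isCompact {f : E → E} (hf : Continuous f) {K : Set E}
    (hK : IsCompact K) (hfK : ∀ x, f x ∈ K) {ε : ℝ} (hε : 0 < ε) : ∃ x, dist x (f x) ≤ ε := by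
  obtain ⟨s, -, hs, hcover⟩ := hK.finite_cover_balls hε
  have := hs.fintype
  obtain ⟨w, hw, hw01, hdist⟩ :=
    exists_partition_dist_le (K := K) ((↑) : s → E) (by rwa [iUnion_coe_set])
  let u : EuclideanSpace ℝ s → E := fun z => ∑ i, z i • (i : E)
  let F : EuclideanSpace ℝ s → EuclideanSpace ℝ s := fun z => WithLp.toLp 2 fun i => w i (f (u z))
  have hF : Continuous F := (PiLp.continuous_toLp 2 _).comp <| continuous_pi fun i =>
    (hw i).comp_continuous (by fun_prop) fun z => hfK (u z)
  obtain ⟨z, hz⟩ := exists_fixedPoint_of_continuous_of_bounded hF fun z =>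
    norm_le_sqrt_card_mul zero_le_one fun i => by
      obtain ⟨h0, h1⟩ := hw01 _ (hfK (u z)) i
      exact (abs_of_nonneg h0).trans_le h1
  have hmean := hdist _ (hfK (u z))
  rw [show ∑ i, w i (f (u z)) • (i : E) = u z from congr_arg u hz] at hmean
  exact ⟨u z, hmean⟩

theorem exists_fixedPoint_of_mapsTo_isCompact {f : E → E} (hf : Continuous f) {K : Set E}
    (hK : IsCompact K) (hfK : ∀ x, f x ∈ K) : ∃ x, f x = x := by
  choose u hu using fun n : ℕ =>
    exists_dist_le_of_mapsTo_isCompact hf hK hfK (Nat.one_div_pos_of_nat (α := ℝ) (n := n))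
  obtain ⟨x, -, φ, hφ, hlim⟩ := hK.tendsto_subseq fun n => hfK (u n)
  have hdist : Tendsto (fun n => dist (u (φ n)) (f (u (φ n)))) atTop (𝓝 0) :=
    squeeze_zero (fun _ => dist_nonneg) (fun n => hu (φ n))
      (tendsto_one_div_add_atTop_nhds_zero_nat.comp hφ.tendsto_atTop)
  have hlim' : Tendsto (fun n => u (φ n)) atTop (𝓝 x) := hlim.congr_dist (by
    simpa only [dist_comm, Function.comp_apply] using hdist)
  exact ⟨x, tendsto_nhds_unique ((hf.tendsto x).comp hlim') hlim⟩

end Schauder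

section Periodic

variable {T : ℝ} {E : Type*} [NormedAddCommGroup E]

lemma isCompact_setOf_lipschitzWith {X : Type*} [PseudoMetricSpace X] [ProperSpace E]
    (L : NNReal) (C : ℝ) : IsCompact {z : C(X, E) | LipschitzWith L z ∧ ∀ θ, ‖z θ‖ ≤ C} := by
  refine ArzelaAscoli.isCompact_of_equicontinuous _ ?_
    (LipschitzWith.uniformEquicontinuous _ L fun z => z.2.1).equicontinuous
  have himage : ContinuousMap.toFun '' {z : C(X, E) | LipschitzWith L z ∧ ∀ θ, ‖z θ‖ ≤ C} =
      univ.pi (fun _ => closedBall 0 C) ∩ {z | LipschitzWith L z} := by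
    ext z
    constructor
    · rintro ⟨z, ⟨hL, hC⟩, rfl⟩
      exact ⟨fun θ _ => mem_closedBall_zero_iff.2 (hC θ), hL⟩
    · rintro ⟨hC, hL⟩
      exact ⟨⟨z, LipschitzWith.continuous hL⟩,
        ⟨hL, fun θ => mem_closedBall_zero_iff.1 (hC θ trivial)⟩, rfl⟩
  rw [himage]
  exact (isCompact_univ_pi fun _ => isCompact_closedBall 0 C).inter_right
    (isClosed_setOfPred_lipschitzWith L)

lemma lipschitzWith_of_comp_coe {z : AddCircle T → E} {L : NNReal}
    (hz : LipschitzWith L fun t : ℝ => z t) : LipschitzWith L z := by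
  refine LipschitzWith.of_dist_le_mul fun θ₁ θ₂ => ?_
  have hlift : ∀ r, dist θ₁ θ₂ < r → dist (z θ₁) (z θ₂) ≤ L * r := by
    intro r hr
    obtain ⟨b, rfl⟩ := QuotientAddGroup.mk_surjective θ₂
    rw [dist_eq_norm] at hr
    obtain ⟨m, hm, hmr⟩ := QuotientAddGroup.norm_lt_iff.1 hr
    obtain rfl : ((b + m : ℝ) : AddCircle T) = θ₁ := by
      rw [AddCircle.coe_add]
      exact (add_comm _ _).trans (eq_sub_iff_add_eq.1 hm)
    refine (hz.dist_le_mul (b + m) b).trans ?_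
    rw [dist_eq_norm, add_sub_cancel_left]
    gcongr
  have hright : Tendsto (fun r : ℝ => (L : ℝ) * r) (𝓝[>] (dist θ₁ θ₂)) (𝓝 (L * dist θ₁ θ₂)) :=
    (Continuous.tendsto (by fun_prop) _).mono_left nhdsWithin_le_nhds
  exact ge_of_tendsto hright (eventually_mem_nhdsWithin.mono hlift)

variable [NormedSpace ℝ E]

/-- For `s, T ≠ 0` and continuous `h`, this is the `T`-periodic solution of `z' = s z + h`, with
`T`-periodic functions encoded as functions on `AddCircle T`. -/
noncomputable def periodicResolvent (s : ℝ) (h : AddCircle T → E) (θ : AddCircle T) : E :=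
  (Real.exp (-(s * T)) - 1)⁻¹ • ∫ τ in (0 : ℝ)..T, Real.exp (-(s * τ)) • h (θ + τ)

lemma exists_norm_periodicResolvent_le (s T : ℝ) :
    ∃ C, ∀ (h : AddCircle T → E) (M : ℝ), (∀ θ, ‖h θ‖ ≤ M) →
      ∀ θ, ‖periodicResolvent s h θ‖ ≤ C * M := by
  refine ⟨|(Real.exp (-(s * T)) - 1)⁻¹| * (Real.exp (|s| * |T|) * |T|), fun h M hM θ => ?_⟩
  rw [periodicResolvent, norm_smul, Real.norm_eq_abs, mul_assoc]
  have hint := intervalIntegral.norm_integral_le_of_norm_le_const (a := 0) (b := T)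
    (f := fun τ : ℝ => Real.exp (-(s * τ)) • h (θ + τ)) (C := Real.exp (|s| * |T|) * M) ?_
  · gcongr
    rw [sub_zero] at hint
    linarith
  · intro τ hτ
    have hτT : |τ| ≤ |T| := by simpa using abs_sub_left_of_mem_uIcc (uIoc_subset_uIcc hτ)
    rw [norm_smul, Real.norm_of_nonneg (Real.exp_pos _).le]
    gcongr
    · calc -(s * τ) ≤ |s * τ| := neg_le_abs _
        _ = |s| * |τ| := abs_mul s τ
        _ ≤ |s| * |T| := by gcongr
    · exact hM _

lemma continuous_periodicResolvent {Z : Type*} [TopologicalSpace Z] [FirstCountableTopology Z]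
    (s : ℝ) {h : Z → AddCircle T → E} (hh : Continuous (Function.uncurry h)) :
    Continuous fun p : Z × AddCircle T => periodicResolvent s (h p.1) p.2 := by
  have hcont : Continuous fun q : (Z × AddCircle T) × ℝ =>
      Real.exp (-(s * q.2)) • h q.1.1 (q.1.2 + q.2) :=
    (by fun_prop : Continuous fun q : (Z × AddCircle T) × ℝ => Real.exp (-(s * q.2))).smul
      (hh.comp (f := fun q : (Z × AddCircle T) × ℝ => (q.1.1, q.1.2 + (q.2 : AddCircle T)))
        (by fun_prop))
  exact (intervalIntegral.continuous_parametric_intervalIntegral_of_continuous'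
    hcont 0 T).const_smul _

lemma hasDerivAt_periodicResolvent [CompleteSpace E] {s : ℝ} (hs : s * T ≠ 0)
    {h : AddCircle T → E} (hh : Continuous h) (t : ℝ) :
    HasDerivAt (fun t : ℝ => periodicResolvent s h t) (s • periodicResolvent s h t + h t) t := by
  let k : ℝ → E := fun u => Real.exp (-(s * u)) • h u
  have hk : Continuous k := by fun_prop
  have hres : (fun t : ℝ => periodicResolvent s h t) = fun t =>
      (Real.exp (-(s * T)) - 1)⁻¹ • Real.exp (s * t) • ∫ u in t..t + T, k u := by
    funext t
    have hshift := intervalIntegral.integral_comp_add_left (a := 0) (b := T) k t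
    rw [add_zero] at hshift
    rw [periodicResolvent, ← hshift, ← intervalIntegral.integral_smul (Real.exp (s * t))]
    have hexponent : ∀ τ, s * t + -(s * (t + τ)) = -(s * τ) := fun τ => by ring
    simp only [k, smul_smul, ← Real.exp_add, AddCircle.coe_add, hexponent]
  have hprim : HasDerivAt (fun t => ∫ u in t..t + T, k u) (k (t + T) - k t) t := by
    have hsplit : (fun t => ∫ u in t..t + T, k u) =
        fun t => (∫ u in (0 : ℝ)..t + T, k u) - ∫ u in (0 : ℝ)..t, k u := funext fun t =>
      (intervalIntegral.integral_interval_sub_left (hk.intervalIntegrable _ _)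
        (hk.intervalIntegrable _ _)).symm
    rw [hsplit]
    exact ((hk.integral_hasStrictDerivAt 0 (t + T)).hasDerivAt.comp_add_const t T).sub
      (hk.integral_hasStrictDerivAt 0 t).hasDerivAt
  have hjump : (Real.exp (-(s * T)) - 1)⁻¹ • Real.exp (s * t) • (k (t + T) - k t) = h t := by
    have hne : Real.exp (-(s * T)) - 1 ≠ 0 := by simpa [sub_eq_zero] using hs
    have hk' : k (t + T) - k t =
        (Real.exp (-(s * t)) * (Real.exp (-(s * T)) - 1)) • h t := by
      simp only [k, AddCircle.coe_add_period, ← sub_smul, mul_add, neg_add, Real.exp_add, mul_sub,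
        mul_one]
    have hscalar : Real.exp (s * t) * (Real.exp (-(s * t)) * (Real.exp (-(s * T)) - 1)) =
        Real.exp (-(s * T)) - 1 := by
      rw [← mul_assoc, ← Real.exp_add, add_neg_cancel, Real.exp_zero, one_mul]
    rw [hk', smul_smul (Real.exp (s * t)), hscalar, smul_smul, inv_mul_cancel₀ hne, one_smul]
  have hexp : HasDerivAt (fun t => Real.exp (s * t)) (s * Real.exp (s * t)) t := by
    simpa [mul_comm] using ((hasDerivAt_id t).const_mul s).exp
  rw [congr_fun hres t, hres]
  refine ((hexp.smul hprim).const_smul _).congr_deriv ?_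
  rw [smul_add, hjump, add_comm, mul_smul, smul_comm _ s]

/-- The phase `(x, x')` of the `T`-periodic solution of `x'' = x + h`. It is assembled from the
solutions `x' + x` and `x' - x` of the decoupled first order equations. -/
noncomputable def periodicPhase (h : AddCircle T → E) (θ : AddCircle T) : E × E :=
  ((2 : ℝ)⁻¹ • (periodicResolvent 1 h θ - periodicResolvent (-1) h θ),
    (2 : ℝ)⁻¹ • (periodicResolvent 1 h θ + periodicResolvent (-1) h θ))

lemma hasDerivAt_periodicPhase [CompleteSpace E] (hT : T ≠ 0) {h : AddCircle T → E}
    (hh : Continuous h) (t : ℝ) :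
    HasDerivAt (fun t : ℝ => periodicPhase h t)
      ((periodicPhase h t).2, (periodicPhase h t).1 + h t) t := by
  have hpos := hasDerivAt_periodicResolvent (s := 1) (by simpa using hT) hh t
  have hneg := hasDerivAt_periodicResolvent (s := -1) (by simpa using hT) hh t
  refine (((hpos.sub hneg).const_smul (2 : ℝ)⁻¹).prodMk
    ((hpos.add hneg).const_smul (2 : ℝ)⁻¹)).congr_deriv (Prod.ext ?_ ?_) <;>
  · simp only [periodicPhase]
    module

lemma exists_norm_periodicPhase_le (T : ℝ) :
    ∃ C, ∀ (h : AddCircle T → E) (M : ℝ), (∀ θ, ‖h θ‖ ≤ M) →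
      ∀ θ, ‖periodicPhase h θ‖ ≤ C * M := by
  obtain ⟨C₁, hpos⟩ := exists_norm_periodicResolvent_le (E := E) 1 T
  obtain ⟨C₂, hneg⟩ := exists_norm_periodicResolvent_le (E := E) (-1) T
  refine ⟨2⁻¹ * (C₁ + C₂), fun h M hM θ => ?_⟩
  have hsum := add_le_add (hpos h M hM θ) (hneg h M hM θ)
  rw [mul_assoc, add_mul]
  refine max_le ?_ ?_ <;> rw [periodicPhase, norm_smul, Real.norm_of_nonneg (by norm_num)]
  · gcongr
    exact (norm_sub_le _ _).trans hsum
  · gcongr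
    exact (norm_add_le _ _).trans hsum

lemma continuous_periodicPhase {Z : Type*} [TopologicalSpace Z] [FirstCountableTopology Z]
    {h : Z → AddCircle T → E} (hh : Continuous (Function.uncurry h)) :
    Continuous fun p : Z × AddCircle T => periodicPhase (h p.1) p.2 :=
  (((continuous_periodicResolvent 1 hh).sub (continuous_periodicResolvent (-1) hh)).const_smul
    _).prodMk
    (((continuous_periodicResolvent 1 hh).add (continuous_periodicResolvent (-1) hh)).const_smul _)

lemma exists_lipschitzWith_periodicPhase [CompleteSpace E] (hT : T ≠ 0) {M : ℝ} :
    ∃ (L : NNReal) (C : ℝ), ∀ h : AddCircle T → E, Continuous h → (∀ θ, ‖h θ‖ ≤ M) →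
      LipschitzWith L (periodicPhase h) ∧ ∀ θ, ‖periodicPhase h θ‖ ≤ C := by
  obtain ⟨C, hbound⟩ := exists_norm_periodicPhase_le (E := E) T
  refine ⟨(C * M + M).toNNReal, C * M, fun h hh hM => ⟨lipschitzWith_of_comp_coe ?_, hbound h M hM⟩⟩
  have hM₀ : 0 ≤ M := (norm_nonneg _).trans (hM 0)
  rw [← lipschitzOnWith_univ]
  refine convex_univ.lipschitzOnWith_of_nnnorm_hasDerivWithin_le
    (fun t _ => (hasDerivAt_periodicPhase hT hh t).hasDerivWithinAt) fun t _ => ?_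
  rw [← norm_toNNReal]
  have hphase := hbound h M hM t
  refine Real.toNNReal_le_toNNReal (max_le ?_ ?_)
  · exact (norm_snd_le _).trans (hphase.trans (le_add_of_nonneg_right hM₀))
  · exact (norm_add_le _ _).trans (add_le_add ((norm_fst_le _).trans hphase) (hM _))

lemma exists_eq_periodicPhase [FiniteDimensional ℝ E] (hT : 0 < T)
    {g : AddCircle T → E × E → E} (hg : Continuous (Function.uncurry g)) {M : ℝ}
    (hM : ∀ θ z, ‖g θ z‖ ≤ M) :
    ∃ z : C(AddCircle T, E × E), ∀ θ, z θ = periodicPhase (fun η => g η (z η)) θ := by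
  have : Fact (0 < T) := ⟨hT⟩
  have : CompleteSpace E := FiniteDimensional.complete ℝ E
  obtain ⟨L, C, hLC⟩ := exists_lipschitzWith_periodicPhase (E := E) hT.ne' (M := M)
  have hsubst : Continuous (Function.uncurry fun (z : C(AddCircle T, E × E)) η => g η (z η)) :=
    hg.comp (f := fun p : C(AddCircle T, E × E) × AddCircle T => (p.2, p.1 p.2)) (by fun_prop)
  let Φ : C(C(AddCircle T, E × E), C(AddCircle T, E × E)) :=
    ContinuousMap.curry ⟨_, continuous_periodicPhase hsubst⟩
  obtain ⟨z, hz⟩ := exists_fixedPoint_of_mapsTo_isCompact Φ.continuous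
    (isCompact_setOf_lipschitzWith L C)
    fun z => hLC _ (hsubst.comp (Continuous.prodMk_right z)) fun η => hM η (z η)
  exact ⟨z, fun θ => (DFunLike.congr_fun hz θ).symm⟩

theorem exists_periodic_solution_of_bounded [FiniteDimensional ℝ E] (hT : 0 < T)
    {g : ℝ → E → E → E} (hg : Continuous fun p : ℝ × E × E => g p.1 p.2.1 p.2.2)
    (hg_per : Function.Periodic g T) {M : ℝ} (hM : ∀ t x y, ‖g t x y‖ ≤ M) :
    ∃ x y : ℝ → E, Function.Periodic x T ∧ (∀ t, HasDerivAt x (y t) t) ∧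
      ∀ t, HasDerivAt y (x t + g t (x t) (y t)) t := by
  let G : AddCircle T → E × E → E := fun θ z => hg_per.lift θ z.1 z.2
  have hG : Continuous (Function.uncurry G) :=
    (QuotientAddGroup.isOpenQuotientMap_mk.prodMap
      (IsOpenQuotientMap.id (X := E × E))).continuous_comp_iff.1 hg
  have hGM : ∀ θ z, ‖G θ z‖ ≤ M := by
    rintro ⟨t⟩ z
    exact hM t z.1 z.2
  obtain ⟨z, hz⟩ := exists_eq_periodicPhase hT hG hGM
  have hderiv : ∀ t : ℝ, HasDerivAt (fun t : ℝ => z t)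
      ((z t).2, (z t).1 + g t (z t).1 (z t).2) t := by
    have : CompleteSpace E := FiniteDimensional.complete ℝ E
    have hcont : Continuous fun η => G η (z η) :=
      hG.comp (continuous_id.prodMk z.continuous)
    intro t
    simpa only [← hz] using! hasDerivAt_periodicPhase hT.ne' hcont t
  exact ⟨fun t => (z t).1, fun t => (z t).2,
    fun t => by simp only [AddCircle.coe_add_period], fun t => (hderiv t).fst,
    fun t => (hderiv t).snd⟩

end Periodic

lemma periodic_deriv {F : Type*} [NormedAddCommGroup F] [NormedSpace ℝ F] {f : ℝ → F} {T : ℝ}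
    (hf : Function.Periodic f T) : Function.Periodic (deriv f) T := fun t => by
  rw [← deriv_comp_add_const, funext hf]

lemma hasDerivAt_euclideanSpace_apply {ι : Type*} [Fintype ι] {x : ℝ → EuclideanSpace ℝ ι}
    {x' : EuclideanSpace ℝ ι} {t : ℝ} (hx : HasDerivAt x x' t) (i : ι) :
    HasDerivAt (fun s => x s i) (x' i) t :=
  (EuclideanSpace.proj (𝕜 := ℝ) i).hasFDerivAt.comp_hasDerivAt t hx

section MaximumPrinciple

lemma exists_forall_le_of_periodic {T : ℝ} (hT : 0 < T) {f : ℝ → ℝ}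
    (hf_per : Function.Periodic f T) (hf : Continuous f) : ∃ s, ∀ t, f s ≤ f t := by
  obtain ⟨_, ⟨s, rfl⟩, hs⟩ :=
    (hf_per.compact_of_continuous hT.ne' hf).exists_isLeast (range_nonempty f)
  exact ⟨s, fun t => hs ⟨t, rfl⟩⟩

lemma deriv_deriv_nonneg_of_isLocalMin {f : ℝ → ℝ} {s : ℝ} (hf : ContinuousAt f s)
    (hmin : IsLocalMin f s) : 0 ≤ deriv (deriv f) s := by
  by_contra! hneg
  have hmax : IsLocalMax f s := isLocalMax_of_deriv_deriv_neg hneg hmin.deriv_eq_zero hf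
  have hconst : f =ᶠ[𝓝 s] fun _ => f s := by
    filter_upwards [hmin, hmax] with t hge hle using le_antisymm hle hge
  simpa [hconst.deriv.deriv_eq] using hneg.ne

lemma lt_of_periodic_of_hasDerivAt {T : ℝ} (hT : 0 < T) {f f' f'' g g' g'' : ℝ → ℝ}
    (hf_per : Function.Periodic f T) (hg_per : Function.Periodic g T)
    (hf : ∀ t, HasDerivAt f (f' t) t) (hf' : ∀ t, HasDerivAt f' (f'' t) t)
    (hg : ∀ t, HasDerivAt g (g' t) t) (hg' : ∀ t, HasDerivAt g' (g'' t) t)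
    (h : ∀ t, g t ≤ f t → f' t = g' t → g'' t < f'' t) (t : ℝ) : f t < g t := by
  have hd : ∀ t, HasDerivAt (g - f) (g' t - f' t) t := fun t => (hg t).sub (hf t)
  have hc : Continuous (g - f) := continuous_iff_continuousAt.2 fun t => (hd t).continuousAt
  obtain ⟨s, hs⟩ := exists_forall_le_of_periodic hT (hg_per.sub hf_per) hc
  have hmin : IsLocalMin (g - f) s := .of_forall hs
  suffices hpos : f s < g s from sub_pos.1 ((sub_pos.2 hpos).trans_le (hs t))
  by_contra! hle
  have hcrit : f' s = g' s := (sub_eq_zero.1 (hmin.hasDerivAt_eq_zero (hd s))).symm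
  have hdd : deriv (deriv (g - f)) s = g'' s - f'' s := by
    rw [funext fun t => (hd t).deriv]
    exact ((hg' s).sub (hf' s)).deriv
  have hnonneg := deriv_deriv_nonneg_of_isLocalMin hc.continuousAt hmin
  rw [hdd, sub_nonneg] at hnonneg
  exact (h s hle hcrit).not_ge hnonneg

end MaximumPrinciple

lemma norm_sq_le_of_hasDerivAt {E : Type*} [NormedAddCommGroup E] [NormedSpace ℝ E]
    {f f' f'' : ℝ → E} {M Q : ℝ}
    (hf : ∀ t, HasDerivAt f (f' t) t) (hf' : ∀ t, HasDerivAt f' (f'' t) t)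
    (hM : ∀ t, ‖f t‖ ≤ M) (hQ : ∀ t, ‖f'' t‖ ≤ Q) (t : ℝ) : ‖f' t‖ ^ 2 ≤ 8 * M * Q := by
  have htaylor : ∀ h : ℝ, 0 ≤ h → h * ‖f' t‖ ≤ 2 * M + Q * (h * h) := by
    intro h hh
    have hvelocity : ∀ s ∈ Icc t (t + h), ‖f' s - f' t‖ ≤ Q * h := fun s hs =>
      (norm_image_sub_le_of_norm_deriv_le_segment' (fun r _ => (hf' r).hasDerivWithinAt)
        (fun r _ => hQ r) s hs).trans
        (mul_le_mul_of_nonneg_left (by linarith [hs.2]) ((norm_nonneg _).trans (hQ t)))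
    have hposition := norm_image_sub_le_of_norm_deriv_le_segment' (f := fun s => f s - s • f' t)
      (fun s _ => ((hf s).sub ((hasDerivAt_id s).smul_const (f' t))).hasDerivWithinAt)
      (fun s hs => by simpa using hvelocity s (Ico_subset_Icc_self hs)) (t + h)
      (right_mem_Icc.2 (by linarith))
    have hchord : h • f' t =
        f (t + h) - f t - (f (t + h) - (t + h) • f' t - (f t - t • f' t)) := by module
    calc h * ‖f' t‖ = ‖h • f' t‖ := by rw [norm_smul, Real.norm_of_nonneg hh]
      _ ≤ ‖f (t + h)‖ + ‖f t‖ + Q * h * (t + h - t) := by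
        rw [hchord]
        exact (norm_sub_le _ _).trans (add_le_add (norm_sub_le _ _) hposition)
      _ ≤ 2 * M + Q * (h * h) := by linarith [hM t, hM (t + h)]
  have hdiscrim : discrim Q (-‖f' t‖) (2 * M) ≤ 0 := discrim_le_zero fun h => by
    rcases le_total 0 h with hh | hh
    · linarith [htaylor h hh]
    · have hM₀ := (norm_nonneg _).trans (hM t)
      have hQ₀ := (norm_nonneg _).trans (hQ t)
      have := mul_nonneg_of_nonpos_of_nonpos (neg_nonpos.2 (norm_nonneg (f' t))) hh
      have := mul_nonneg hQ₀ (mul_self_nonneg h)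
      linarith
  rw [discrim] at hdiscrim
  linarith

lemma exists_norm_le_of_periodic {T : ℝ} (hT : T ≠ 0) {X F : Type*} [TopologicalSpace X]
    [SeminormedAddCommGroup F] {f : ℝ → X → F} (hf : Continuous (Function.uncurry f))
    (hf_per : Function.Periodic f T) {K : Set X} (hK : IsCompact K) :
    ∃ D, ∀ t, ∀ p ∈ K, ‖f t p‖ ≤ D := by
  obtain ⟨D, hD⟩ := (isCompact_uIcc.prod hK).exists_bound_of_continuousOn
    (s := uIcc 0 T ×ˢ K) hf.continuousOn
  refine ⟨D, fun t p hp => ?_⟩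
  obtain ⟨s, hs, hts⟩ : ∃ s ∈ uIcc 0 T, f t = f s := by
    have := hf_per.image_uIcc hT 0
    rw [zero_add] at this
    obtain ⟨s, hs, h⟩ := this.symm.subset (mem_range_self t)
    exact ⟨s, hs, h.symm⟩
  rw [hts]
  exact hD (s, p) ⟨hs, hp⟩

section BoxClamp

variable {ι : Type*}

/-- The coordinatewise truncation of a vector to the box `∏ i, [a i, b i]`, which is its nearest
point in the box if `a ≤ b`. -/
noncomputable def boxClamp (a b : ι → ℝ) (x : EuclideanSpace ℝ ι) : EuclideanSpace ℝ ι :=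
  WithLp.toLp 2 fun i => max (a i) (min (b i) (x i))

variable {a b : ι → ℝ} {x : EuclideanSpace ℝ ι} {i : ι}

lemma boxClamp_apply_mem_Icc (hab : a ≤ b) (x : EuclideanSpace ℝ ι) (i : ι) :
    boxClamp a b x i ∈ Icc (a i) (b i) :=
  ⟨le_max_left _ _, max_le (hab i) (min_le_left _ _)⟩

lemma boxClamp_apply_of_mem (hx : x i ∈ Icc (a i) (b i)) : boxClamp a b x i = x i := by
  simp only [boxClamp, min_eq_right hx.2, max_eq_right hx.1]

lemma boxClamp_apply_of_le (hab : a i ≤ b i) (hx : x i ≤ a i) : boxClamp a b x i = a i := by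
  simp only [boxClamp, min_eq_right (hx.trans hab), max_eq_left hx]

lemma boxClamp_apply_of_ge (hab : a i ≤ b i) (hx : b i ≤ x i) : boxClamp a b x i = b i := by
  simp only [boxClamp, min_eq_left hx, max_eq_right hab]

lemma boxClamp_of_forall_mem (hx : ∀ i, x i ∈ Icc (a i) (b i)) : boxClamp a b x = x :=
  PiLp.ext fun i => boxClamp_apply_of_mem (hx i)

lemma continuous_boxClamp :
    Continuous fun p : (ι → ℝ) × (ι → ℝ) × EuclideanSpace ℝ ι => boxClamp p.1 p.2.1 p.2.2 :=
  (PiLp.continuous_toLp 2 _).comp (by fun_prop)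

end BoxClamp

section Truncation

variable {ι : Type*} {T B R Q : ℝ}
  {v : ℝ → EuclideanSpace ℝ ι → EuclideanSpace ℝ ι → EuclideanSpace ℝ ι} {α β : ι → ℝ → ℝ}

/-- The nonlinearity of the truncated system `x'' = x + truncatedField v α β R t x x'`. As long as
`x` stays between the barriers `α`, `β` and the components of `x'` stay in `[-R, R]`, this system
is `x'' = v t x x'`. -/
noncomputable def truncatedField
    (v : ℝ → EuclideanSpace ℝ ι → EuclideanSpace ℝ ι → EuclideanSpace ℝ ι) (α β : ι → ℝ → ℝ)
    (R t : ℝ) (x y : EuclideanSpace ℝ ι) : EuclideanSpace ℝ ι :=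
  v t (boxClamp (α · t) (β · t) x) (boxClamp (fun _ => -R) (fun _ => R) y) -
    boxClamp (α · t) (β · t) x

lemma periodic_truncatedField (hv_per : Function.Periodic v T)
    (hα_per : ∀ i, Function.Periodic (α i) T) (hβ_per : ∀ i, Function.Periodic (β i) T) :
    Function.Periodic (truncatedField v α β R) T := fun t => by
  ext
  simp only [truncatedField, hv_per t, hα_per _ t, hβ_per _ t]

lemma continuous_truncatedField [Finite ι]
    (hv : Continuous fun p : ℝ × EuclideanSpace ℝ ι × EuclideanSpace ℝ ι => v p.1 p.2.1 p.2.2)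
    (hα : ∀ i, Continuous (α i)) (hβ : ∀ i, Continuous (β i)) :
    Continuous fun p : ℝ × EuclideanSpace ℝ ι × EuclideanSpace ℝ ι =>
      truncatedField v α β R p.1 p.2.1 p.2.2 := by
  have := Fintype.ofFinite ι
  have hposition : Continuous fun p : ℝ × EuclideanSpace ℝ ι × EuclideanSpace ℝ ι =>
      boxClamp (α · p.1) (β · p.1) p.2.1 :=
    continuous_boxClamp.comp (f := fun p : ℝ × EuclideanSpace ℝ ι × EuclideanSpace ℝ ι =>
      ((α · p.1), (β · p.1), p.2.1)) (by fun_prop)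
  have hvelocity : Continuous fun y : EuclideanSpace ℝ ι => boxClamp (fun _ => -R) (fun _ => R) y :=
    continuous_boxClamp.comp (f := fun y : EuclideanSpace ℝ ι =>
      ((fun _ => -R), (fun _ => R), y)) (by fun_prop)
  exact (hv.comp (continuous_fst.prodMk (hposition.prodMk
    (hvelocity.comp (continuous_snd.comp continuous_snd))))).sub hposition

variable [Fintype ι]

lemma norm_truncatedField_le (hR : 0 ≤ R) (hαβ : ∀ i t, α i t ≤ β i t)
    (hB : ∀ t (x : EuclideanSpace ℝ ι), (∀ i, x i ∈ Icc (α i t) (β i t)) → ‖x‖ ≤ B)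
    (hQ : ∀ t x y, (∀ i, x i ∈ Icc (α i t) (β i t)) → (∀ i, y i ∈ Icc (-R) R) → ‖v t x y‖ ≤ Q)
    (t : ℝ) (x y : EuclideanSpace ℝ ι) : ‖truncatedField v α β R t x y‖ ≤ Q + B := by
  have hposition := boxClamp_apply_mem_Icc (a := (α · t)) (b := (β · t)) (hαβ · t) x
  have hvelocity := boxClamp_apply_mem_Icc (fun _ => neg_le_self hR) y
  exact (norm_sub_le _ _).trans (add_le_add (hQ t _ _ hposition hvelocity) (hB t _ hposition))

lemma mem_Ioo_of_truncatedField (hT : 0 < T) (hαβ : ∀ i t, α i t ≤ β i t)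
    (hα : ∀ i, ContDiff ℝ 2 (α i)) (hβ : ∀ i, ContDiff ℝ 2 (β i))
    (hα_per : ∀ i, Function.Periodic (α i) T) (hβ_per : ∀ i, Function.Periodic (β i) T)
    (hαR : ∀ i t, deriv (α i) t ∈ Icc (-R) R) (hβR : ∀ i t, deriv (β i) t ∈ Icc (-R) R)
    (hlower : ∀ j t (x y : EuclideanSpace ℝ ι), (∀ i, x i ∈ Icc (α i t) (β i t)) →
      x j = α j t → y j = deriv (α j) t → v t x y j < deriv (deriv (α j)) t)
    (hupper : ∀ j t (x y : EuclideanSpace ℝ ι), (∀ i, x i ∈ Icc (α i t) (β i t)) →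
      x j = β j t → y j = deriv (β j) t → deriv (deriv (β j)) t < v t x y j)
    {x y : ℝ → EuclideanSpace ℝ ι} (hx_per : Function.Periodic x T)
    (hx : ∀ t, HasDerivAt x (y t) t)
    (hy : ∀ t, HasDerivAt y (x t + truncatedField v α β R t (x t) (y t)) t) (j : ι) (t : ℝ) :
    x t j ∈ Ioo (α j t) (β j t) := by
  have hxj_per : Function.Periodic (fun t => x t j) T := fun t => by simp only [hx_per t]
  have hxj := fun t => hasDerivAt_euclideanSpace_apply (hx t) j
  have hyj := fun t => hasDerivAt_euclideanSpace_apply (hy t) j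
  have hderiv : ∀ {f : ℝ → ℝ}, ContDiff ℝ 2 f →
      (∀ t, HasDerivAt f (deriv f t) t) ∧ ∀ t, HasDerivAt (deriv f) (deriv (deriv f) t) t :=
    fun hf => ⟨fun t => (hf.differentiable two_ne_zero t).hasDerivAt,
      fun t => (hf.differentiable_deriv_two t).hasDerivAt⟩
  have hbox := fun t =>
    boxClamp_apply_mem_Icc (a := (α · t)) (b := (β · t)) (hαβ · t) (x t)
  constructor
  · refine lt_of_periodic_of_hasDerivAt hT (hα_per j) hxj_per (hderiv (hα j)).1 (hderiv (hα j)).2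
      hxj hyj (fun t hle hslope => ?_) t
    have hpos : boxClamp (α · t) (β · t) (x t) j = α j t := boxClamp_apply_of_le (hαβ j t) hle
    have hvel : boxClamp (fun _ => -R) (fun _ => R) (y t) j = deriv (α j) t := by
      rw [hslope, boxClamp_apply_of_mem (hslope ▸ hαR j t)]
    have hlt := hlower j t _ _ (hbox t) hpos hvel
    simp only [truncatedField, PiLp.add_apply, PiLp.sub_apply, hpos]
    linarith
  · refine lt_of_periodic_of_hasDerivAt hT hxj_per (hβ_per j) hxj hyj (hderiv (hβ j)).1
      (hderiv (hβ j)).2 (fun t hle hslope => ?_) t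
    have hpos : boxClamp (α · t) (β · t) (x t) j = β j t := boxClamp_apply_of_ge (hαβ j t) hle
    have hvel : boxClamp (fun _ => -R) (fun _ => R) (y t) j = deriv (β j) t := by
      rw [← hslope, boxClamp_apply_of_mem (hslope ▸ hβR j t)]
    have hlt := hupper j t _ _ (hbox t) hpos hvel
    simp only [truncatedField, PiLp.add_apply, PiLp.sub_apply, hpos]
    linarith

lemma hasDerivAt_of_truncatedField (hR : 0 ≤ R) (hBQR : 8 * B * Q ≤ R ^ 2)
    (hB : ∀ t (x : EuclideanSpace ℝ ι), (∀ i, x i ∈ Icc (α i t) (β i t)) → ‖x‖ ≤ B)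
    (hQ : ∀ t x y, (∀ i, x i ∈ Icc (α i t) (β i t)) → (∀ i, y i ∈ Icc (-R) R) → ‖v t x y‖ ≤ Q)
    {x y : ℝ → EuclideanSpace ℝ ι} (hmem : ∀ t i, x t i ∈ Icc (α i t) (β i t))
    (hx : ∀ t, HasDerivAt x (y t) t)
    (hy : ∀ t, HasDerivAt y (x t + truncatedField v α β R t (x t) (y t)) t) (t : ℝ) :
    HasDerivAt y (v t (x t) (y t)) t := by
  have hy' : ∀ t, HasDerivAt y (v t (x t) (boxClamp (fun _ => -R) (fun _ => R) (y t))) t := by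
    intro t
    simpa only [truncatedField, boxClamp_of_forall_mem (hmem t), add_sub_cancel] using hy t
  have hyR : ‖y t‖ ≤ R := le_of_sq_le_sq ((norm_sq_le_of_hasDerivAt hx hy'
    (fun t => hB t _ (hmem t)) (fun t => hQ t _ _ (hmem t)
      (boxClamp_apply_mem_Icc (fun _ => neg_le_self hR) (y t))) t).trans hBQR) hR
  have hvel : boxClamp (fun _ => -R) (fun _ => R) (y t) = y t :=
    boxClamp_of_forall_mem fun i => abs_le.1 ((PiLp.norm_apply_le (y t) i).trans hyR)
  simpa only [hvel] using hy' t

end Truncation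

lemma exists_abs_le_of_periodic {ι : Type*} [Finite ι] {T : ℝ} (hT : T ≠ 0)
    {f : ι → ℝ → ℝ} (hf : ∀ i, Continuous (f i)) (hf_per : ∀ i, Function.Periodic (f i) T) :
    ∃ M, 0 ≤ M ∧ ∀ i t, |f i t| ≤ M := by
  have := Fintype.ofFinite ι
  have hper : Function.Periodic (fun t i => f i t) T := fun t => funext fun i => hf_per i t
  obtain ⟨M, hM, hbound⟩ :=
    (hper.isBounded_of_continuous hT (by fun_prop)).exists_pos_norm_le
  exact ⟨M, hM.le, fun i t => (norm_le_pi_norm _ i).trans (hbound _ ⟨t, rfl⟩)⟩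

section APrioriBounds

variable {ι : Type*} [Fintype ι] {T : ℝ}

lemma exists_norm_le_of_mem_Icc (hT : T ≠ 0) {α β : ι → ℝ → ℝ}
    (hα : ∀ i, Continuous (α i)) (hβ : ∀ i, Continuous (β i))
    (hα_per : ∀ i, Function.Periodic (α i) T) (hβ_per : ∀ i, Function.Periodic (β i) T) :
    ∃ B, 0 ≤ B ∧
      ∀ t (x : EuclideanSpace ℝ ι), (∀ i, x i ∈ Icc (α i t) (β i t)) → ‖x‖ ≤ B := by
  obtain ⟨A, hA₀, hA⟩ := exists_abs_le_of_periodic hT hα hα_per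
  obtain ⟨B, -, hB⟩ := exists_abs_le_of_periodic hT hβ hβ_per
  refine ⟨√(Fintype.card ι) * max A B, by positivity, fun t x hx =>
    norm_le_sqrt_card_mul (by positivity) fun i => ?_⟩
  exact (abs_le_max_abs_abs (hx i).1 (hx i).2).trans (max_le_max (hA i t) (hB i t))

variable {v : ℝ → EuclideanSpace ℝ ι → EuclideanSpace ℝ ι → EuclideanSpace ℝ ι}
  {S : ℝ → EuclideanSpace ℝ ι → Prop} {B : ℝ}

lemma exists_norm_le_add_mul_sq (hT : T ≠ 0)
    (hv : Continuous fun p : ℝ × EuclideanSpace ℝ ι × EuclideanSpace ℝ ι => v p.1 p.2.1 p.2.2)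
    (hv_per : Function.Periodic v T) (hB : ∀ t x, S t x → ‖x‖ ≤ B) {ε r : ℝ} (hε : 0 ≤ ε)
    (hr : ∀ t x y, S t x → r ≤ ‖y‖ → ‖v t x y‖ ≤ ε * ‖y‖ ^ 2) :
    ∃ D, 0 ≤ D ∧ ∀ t x y, S t x → ‖v t x y‖ ≤ D + ε * ‖y‖ ^ 2 := by
  obtain ⟨D, hD⟩ := exists_norm_le_of_periodic hT (f := fun t p => v t p.1 p.2) hv
    (fun t => by simp only [hv_per t])
    ((isCompact_closedBall (0 : EuclideanSpace ℝ ι) B).prod (isCompact_closedBall 0 r))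
  refine ⟨|D|, abs_nonneg D, fun t x y hx => ?_⟩
  rcases le_total r ‖y‖ with hry | hyr
  · linarith [hr t x y hx hry, abs_nonneg D]
  · have hvD := hD t (x, y)
      ⟨mem_closedBall_zero_iff.2 (hB t x hx), mem_closedBall_zero_iff.2 hyr⟩
    have := mul_nonneg hε (sq_nonneg ‖y‖)
    linarith [le_abs_self D]

lemma exists_truncation_level (hT : T ≠ 0)
    (hv : Continuous fun p : ℝ × EuclideanSpace ℝ ι × EuclideanSpace ℝ ι => v p.1 p.2.1 p.2.2)
    (hv_per : Function.Periodic v T) (hB₀ : 0 ≤ B) (hB : ∀ t x, S t x → ‖x‖ ≤ B)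
    (hgrowth : ∀ ε > 0, ∃ r, ∀ t x y, S t x → r ≤ ‖y‖ → ‖v t x y‖ ≤ ε * ‖y‖ ^ 2) (M : ℝ) :
    ∃ R Q, 0 ≤ R ∧ M ≤ R ∧ 8 * B * Q ≤ R ^ 2 ∧
      ∀ t x y, S t x → (∀ i, y i ∈ Icc (-R) R) → ‖v t x y‖ ≤ Q := by
  set N : ℝ := √(Fintype.card ι)
  set ε : ℝ := (16 * B * N ^ 2 + 1)⁻¹
  have hε : 0 < ε := by positivity
  obtain ⟨r, hr⟩ := hgrowth ε hε
  obtain ⟨D, hD₀, hD⟩ := exists_norm_le_add_mul_sq hT hv hv_per hB hε.le hr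
  set R : ℝ := max M (16 * B * D + 1)
  have hBDR : 16 * B * D + 1 ≤ R := le_max_right _ _
  have hR : 1 ≤ R := le_trans (by linarith [mul_nonneg hB₀ hD₀]) hBDR
  refine ⟨R, D + ε * (N * R) ^ 2, by linarith, le_max_left _ _, ?_, fun t x y hx hy => ?_⟩
  · have hεB : 16 * B * N ^ 2 * ε ≤ 1 := by
      rw [← div_eq_mul_inv, div_le_one (by positivity)]
      linarith
    have hRR : R ≤ R ^ 2 := by nlinarith
    have hvel : 16 * B * (ε * (N * R) ^ 2) ≤ R ^ 2 :=
      calc 16 * B * (ε * (N * R) ^ 2) = 16 * B * N ^ 2 * ε * R ^ 2 := by ring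
        _ ≤ 1 * R ^ 2 := by gcongr
        _ = R ^ 2 := one_mul _
    linarith
  · refine (hD t x y hx).trans ?_
    gcongr
    exact norm_le_sqrt_card_mul (by linarith) fun i => abs_le.2 (hy i)

end APrioriBounds

lemma exists_add_mul_rpow_le_mul_sq (a b : ℝ) {δ ε : ℝ} (hδ : 0 < δ) (hε : 0 < ε) :
    ∃ r > 0, ∀ s, r ≤ s → a + b * s ^ (2 - δ) ≤ ε * s ^ 2 := by
  have htendsto : Tendsto (fun s : ℝ => a * s ^ (-2 : ℝ) + b * s ^ (-δ)) atTop (𝓝 0) := by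
    simpa using ((tendsto_rpow_neg_atTop two_pos).const_mul a).add
      ((tendsto_rpow_neg_atTop hδ).const_mul b)
  obtain ⟨r, hr⟩ := eventually_atTop.1
    ((htendsto.eventually_le_const hε).and (eventually_gt_atTop 0))
  refine ⟨r, (hr r le_rfl).2, fun s hs => ?_⟩
  obtain ⟨hle, hs₀⟩ := hr s hs
  calc a + b * s ^ (2 - δ) = (a * s ^ (-2 : ℝ) + b * s ^ (-δ)) * s ^ 2 := by
        rw [Real.rpow_sub hs₀, Real.rpow_neg hs₀.le, Real.rpow_neg hs₀.le, Real.rpow_two]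
        field_simp
    _ ≤ ε * s ^ 2 := by gcongr

lemma isSecondOrderSolution_of_hasDerivAt {n : ℕ}
    {v : ℝ → EuclideanSpace ℝ (Fin n) → EuclideanSpace ℝ (Fin n) → EuclideanSpace ℝ (Fin n)}
    {x y : ℝ → EuclideanSpace ℝ (Fin n)} (hx : ∀ t, HasDerivAt x (y t) t)
    (hy : ∀ t, HasDerivAt y (v t (x t) (y t)) t) : IsSecondOrderSolution v x := fun t => by
  have hderiv : deriv x = y := funext fun t => (hx t).deriv
  exact ⟨(hx t).differentiableAt, hderiv ▸ hy t⟩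

theorem theorem3p3_general (n : ℕ) (T : ℝ) (hT : 0 < T)
    (v : ℝ → EuclideanSpace ℝ (Fin n) → EuclideanSpace ℝ (Fin n) → EuclideanSpace ℝ (Fin n))
    (hv : Continuous
      (fun p : ℝ × EuclideanSpace ℝ (Fin n) × EuclideanSpace ℝ (Fin n) => v p.1 p.2.1 p.2.2))
    (hv_per : ∀ t x y, v (t + T) x y = v t x y)
    (x₁ x₂ : Fin n → ℝ → ℝ)
    (hx₁ : ∀ j, ContDiff ℝ 2 (x₁ j)) (hx₂ : ∀ j, ContDiff ℝ 2 (x₂ j))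
    (hx₁_per : ∀ j, Function.Periodic (x₁ j) T) (hx₂_per : ∀ j, Function.Periodic (x₂ j) T)
    (hle : ∀ j t, x₁ j t ≤ x₂ j t)
    (hlower : ∀ (j : Fin n) (t : ℝ) (x y : EuclideanSpace ℝ (Fin n)),
      (∀ i, x i ∈ Icc (x₁ i t) (x₂ i t)) → x j = x₁ j t → y j = deriv (x₁ j) t →
        v t x y j < deriv (deriv (x₁ j)) t)
    (hupper : ∀ (j : Fin n) (t : ℝ) (x y : EuclideanSpace ℝ (Fin n)),
      (∀ i, x i ∈ Icc (x₁ i t) (x₂ i t)) → x j = x₂ j t → y j = deriv (x₂ j) t →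
        deriv (deriv (x₂ j)) t < v t x y j)
    (hgrowth : ∀ ε > 0, ∃ r, ∀ t x y, (∀ i, x i ∈ Icc (x₁ i t) (x₂ i t)) → r ≤ ‖y‖ →
      ‖v t x y‖ ≤ ε * ‖y‖ ^ 2) :
    ∃ x : ℝ → EuclideanSpace ℝ (Fin n),
      IsSecondOrderSolution v x ∧ Function.Periodic x T ∧
        ∀ j t, x₁ j t < x t j ∧ x t j < x₂ j t := by
  have hv_per : Function.Periodic v T := fun t => funext₂ (hv_per t)
  have hx₁c := fun j => (hx₁ j).continuous
  have hx₂c := fun j => (hx₂ j).continuous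
  obtain ⟨B, hB₀, hB⟩ := exists_norm_le_of_mem_Icc hT.ne' hx₁c hx₂c hx₁_per hx₂_per
  obtain ⟨M₁, -, hM₁⟩ := exists_abs_le_of_periodic hT.ne'
    (fun j => (hx₁ j).continuous_deriv one_le_two) fun j => periodic_deriv (hx₁_per j)
  obtain ⟨M₂, -, hM₂⟩ := exists_abs_le_of_periodic hT.ne'
    (fun j => (hx₂ j).continuous_deriv one_le_two) fun j => periodic_deriv (hx₂_per j)
  obtain ⟨R, Q, hR, hMR, hBQR, hQ⟩ :=
    exists_truncation_level hT.ne' hv hv_per hB₀ hB hgrowth (max M₁ M₂)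
  obtain ⟨x, y, hx_per, hx, hy⟩ := exists_periodic_solution_of_bounded hT
    (g := truncatedField v x₁ x₂ R) (continuous_truncatedField hv hx₁c hx₂c)
    (periodic_truncatedField hv_per hx₁_per hx₂_per)
    (norm_truncatedField_le hR hle hB hQ)
  have hmem := mem_Ioo_of_truncatedField hT hle hx₁ hx₂ hx₁_per hx₂_per
    (fun j t => abs_le.1 ((hM₁ j t).trans ((le_max_left _ _).trans hMR)))
    (fun j t => abs_le.1 ((hM₂ j t).trans ((le_max_right _ _).trans hMR)))
    hlower hupper hx_per hx hy
  exact ⟨x, isSecondOrderSolution_of_hasDerivAt hx (hasDerivAt_of_truncatedField hR hBQR hB hQ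
    (fun t i => Ioo_subset_Icc_self (hmem i t)) hx hy), hx_per, hmem⟩

theorem theorem3p3 (n : ℕ) (T : ℝ) (hT : 0 < T)
    (v : ℝ → EuclideanSpace ℝ (Fin n) → EuclideanSpace ℝ (Fin n) → EuclideanSpace ℝ (Fin n))
    (hv_smooth : ContDiff ℝ ∞
      (fun p : ℝ × EuclideanSpace ℝ (Fin n) × EuclideanSpace ℝ (Fin n) => v p.1 p.2.1 p.2.2))
    (hv_per : ∀ t x y, v (t + T) x y = v t x y)
    -- `x₁ j` and `x₂ j` are the lower and the upper bounding function of the `j`-th coordinate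
    (x₁ x₂ : Fin n → ℝ → ℝ)
    (hx₁_smooth : ∀ j, ContDiff ℝ ∞ (x₁ j)) (hx₂_smooth : ∀ j, ContDiff ℝ ∞ (x₂ j))
    (hx₁_per : ∀ j, Function.Periodic (x₁ j) T) (hx₂_per : ∀ j, Function.Periodic (x₂ j) T)
    (hlt : ∀ j t, x₁ j t < x₂ j t)
    (hlower : ∀ (j : Fin n) (t : ℝ) (x y : EuclideanSpace ℝ (Fin n)),
      (∀ i, x i ∈ Set.Icc (x₁ i t) (x₂ i t)) → x j = x₁ j t → y j = deriv (x₁ j) t →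
        v t x y j < deriv (deriv (x₁ j)) t)
    (hupper : ∀ (j : Fin n) (t : ℝ) (x y : EuclideanSpace ℝ (Fin n)),
      (∀ i, x i ∈ Set.Icc (x₁ i t) (x₂ i t)) → x j = x₂ j t → y j = deriv (x₂ j) t →
        deriv (deriv (x₂ j)) t < v t x y j)
    -- the bound at `y = 0` follows by continuity if `δ ≤ 2` and is no restriction if `2 < δ`
    (a b δ : ℝ) (hδ : 0 < δ)
    (hgrowth : ∀ t x y, y ≠ 0 → ‖v t x y‖ ≤ a + b * ‖y‖ ^ (2 - δ)) :
    ∃ x : ℝ → EuclideanSpace ℝ (Fin n),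
      IsSecondOrderSolution v x ∧ Function.Periodic x T ∧
        ∀ j t, x₁ j t < x t j ∧ x t j < x₂ j t :=
  theorem3p3_general n T hT v hv_smooth.continuous hv_per x₁ x₂
    (fun j => contDiff_infty.1 (hx₁_smooth j) 2) (fun j => contDiff_infty.1 (hx₂_smooth j) 2)
    hx₁_per hx₂_per (fun j t => (hlt j t).le) hlower hupper fun ε hε => by
      obtain ⟨r, hr, hrε⟩ := exists_add_mul_rpow_le_mul_sq a b hδ hε
      exact ⟨r, fun t x y _ hy =>
        (hgrowth t x y (norm_pos_iff.1 (hr.trans_le hy))).trans (hrε _ hy)⟩
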